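/- Let $S$ be a semigroup with zero. A 0-module over $S$ is an abelian group $A$ with a map $(S\setminus 0)\times A\to A$ such that $s(a+b)=sa+sb$, and $s(ta)=(st)a$ whenever $st\neq 0$. For $n\ge 0$ let $C_0^n(S,A)$ be the group of partial $n$-place maps from $S$ to $A$ defined exactly on the tuples $(x_1,\dots,x_n)$ with $x_1\cdots x_n\ne 0$ (so $C_0^0(S,A)=A$), with coboundary $$(\partial^n f)(x_1,\dots,x_{n+1})=x_1f(x_2,\dots,x_{n+1})+\sum_{i=1}^n(-1)^if(x_1,\dots,x_ix_{i+1},\dots,x_{n+1})+(-1)^{n+1}f(x_1,\dots,x_n),$$ and let $H_0^n(S,A)=\operatorname{Ker}\partial^n/\operatorname{Im}\partial^{n-1}$. The 0-cohomological dimension of $S$ is the least $n$ such that $H_0^{n+1}(S,A)=0$ for every 0-module $A$. A monoid with zero is called 0-free if it is isomorphic to the (Rees) quotient of a free monoid by a nonempty two-sided ideal, or to a free monoid with an adjoined zero. **Theorem 15.** Every 0-free monoid $M$ has 0-cohomological dimension at most $1$; moreover $H_0^n(M,A)=0$ for all $n\ge 2$ and all 0-modules $A$ over $M$. A projective representation of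 $M$ over a field $K$ of degree $n$ is a map $\Gamma:M\to \mathrm{Mat}_nK$ such that (1) $\Gamma(xy)=0\iff\Gamma(x)\Gamma(y)=0$ for all $x,y\in M$, and (2) there is a map $\rho:\{(x,y):\Gamma(xy)\neq 0\}\to K^\times$ with $\Gamma(x)\Gamma(y)=\rho(x,y)\,\Gamma(xy)$ on its domain. Projective representations of infinite degree are defined in the same way, with the algebra $\mathrm{End}_K V$ of a $K$-vector space $V$ in place of $\mathrm{Mat}_nK$. A linear representation is a semigroup homomorphism into the multiplicative semigroup of $\mathrm{Mat}_nK$ (or $\mathrm{End}_KV$), and $\Gamma,\Gamma'$ are equivalent if $\Gamma(x)=c(x)\Gamma'(x)$ for some function $c:M\to K^\times$. **Corollary 7.** Every projective representation of a 0-free monoid $M$ over a field $K$, of finite or infinite degree, is equivalent to a linear one. -/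

import Mathlib

universe u v w k l

/-! ### Ideals, Rees quotients and 0-free monoids -/

/-- `I` is a (nonempty, two-sided) ideal of the semigroup `S`. -/
def IsTwoSidedIdeal {S : Type u} [Mul S] (I : Set S) : Prop :=
  I.Nonempty ∧ ∀ x ∈ I, ∀ s : S, s * x ∈ I ∧ x * s ∈ I

/-- The Rees congruence of an ideal `I`: it collapses `I` to one point and identifies nothing else.
The quotient `(reesCon I hI).Quotient` is the quotient of `S` by the ideal `I`. -/
def reesCon {S : Type u} [Mul S] (I : Set S) (hI : IsTwoSidedIdeal I) : Con S where
  r x y := x = y ∨ (x ∈ I ∧ y ∈ I)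
  iseqv :=
    { refl := fun _ => Or.inl rfl
      symm := by
        rintro x y (h | h)
        · exact Or.inl h.symm
        · exact Or.inr h.symm
      trans := by
        rintro x y z (rfl | h) (rfl | h')
        · exact Or.inl rfl
        · exact Or.inr h'
        · exact Or.inr h
        · exact Or.inr ⟨h.1, h'.2⟩ }
  mul' := by
    rintro a b c d (rfl | h) (rfl | h')
    · exact Or.inl rfl
    · exact Or.inr ⟨(hI.2 _ h'.1 _).1, (hI.2 _ h'.2 _).1⟩
    · exact Or.inr ⟨(hI.2 _ h.1 _).2, (hI.2 _ h.2 _).2⟩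
    · exact Or.inr ⟨(hI.2 _ h.1 _).2, (hI.2 _ h.2 _).2⟩

/-- A monoid with zero is 0-free if it is (isomorphic to) the quotient of a free monoid by an ideal,
or a free monoid with an adjoined zero. -/
def IsZeroFree (M : Type u) [MonoidWithZero M] : Prop :=
  ∃ X : Type v,
    (∃ (I : Set (FreeMonoid X)) (hI : IsTwoSidedIdeal I),
      Nonempty (M ≃* (reesCon I hI).Quotient)) ∨
    Nonempty (M ≃* WithZero (FreeMonoid X))

/-! ### 0-modules and 0-cohomology -/

/-- A 0-module over a semigroup `S` with zero: an abelian group `A` with a map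
`(S \ 0) × A → A`, additive in `A`, such that `s (t a) = (s t) a` whenever `s t ≠ 0`. -/
class ZeroModule (S : Type u) (A : Type w) [SemigroupWithZero S] [AddCommGroup A] where
  /-- the action of the nonzero elements -/
  act : {s : S // s ≠ 0} → A → A
  act_add : ∀ (s : {s : S // s ≠ 0}) (a b : A), act s (a + b) = act s a + act s b
  act_act : ∀ (s t : {s : S // s ≠ 0}) (h : s.1 * t.1 ≠ 0) (a : A),
    act s (act t a) = act ⟨s.1 * t.1, h⟩ a

section Cohomology

variable (S : Type u) [MonoidWithZero S]

/-- The `n`-tuples `(x₁, …, xₙ)` of elements of `S` with `x₁ ⋯ xₙ ≠ 0`; for `n = 0` there is exactly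
one such tuple, the empty one. -/
def ZeroNerve (n : ℕ) : Type u :=
  {x : Fin n → S // n ≠ 0 → (List.ofFn x).prod ≠ 0}

/-- The `n`-dimensional cochains of `S` with values in `A`: the partial `n`-place mappings defined
on the tuples with nonzero product. -/
abbrev ZeroCochain (A : Type w) (n : ℕ) : Type (max u w) :=
  ZeroNerve S n → A

variable {S}

theorem exists_prod_contractNth_mul {n : ℕ} (j : Fin (n + 1)) (x : Fin (n + 1) → S) :
    ∃ c : S, (List.ofFn x).prod = (List.ofFn (j.contractNth (· * ·) x)).prod * c := by
  induction n with
  | zero => exact ⟨x 0, by simp⟩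
  | succ n ih =>
    refine Fin.cases ?_ (fun i => ?_) j
    · refine ⟨1, ?_⟩
      have h : ∀ i : Fin n, (0 : Fin (n + 2)).contractNth (· * ·) x i.succ = x i.succ.succ :=
        fun i => Fin.contractNth_apply_of_gt _ _ _ _ (by simp)
      have h0 : (0 : Fin (n + 2)).contractNth (· * ·) x 0 = x 0 * x 1 :=
        Fin.contractNth_apply_of_eq _ _ _ _ (by simp)
      simp [List.ofFn_succ, h, h0, mul_assoc]
    · obtain ⟨c, hc⟩ := ih i (fun k => x k.succ)
      refine ⟨c, ?_⟩
      have h : ∀ m : Fin n, i.succ.contractNth (· * ·) x m.succ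
          = i.contractNth (· * ·) (fun k => x k.succ) m := by
        intro m
        simp [Fin.contractNth]
      have h0 : i.succ.contractNth (· * ·) x 0 = x 0 :=
        Fin.contractNth_apply_of_lt _ _ _ _ (by simp)
      rw [List.ofFn_succ, List.prod_cons, hc, List.ofFn_succ, List.prod_cons, h0, mul_assoc]
      simp only [h]

namespace ZeroNerve

variable {n : ℕ}

/-- `x₁`, as a nonzero element. -/
def head (x : ZeroNerve S (n + 1)) : {s : S // s ≠ 0} :=
  ⟨x.1 0, fun h => x.2 n.succ_ne_zero (by rw [List.ofFn_succ, List.prod_cons, h, zero_mul])⟩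

/-- `(x₂, …, xₙ₊₁)` -/
def tail (x : ZeroNerve S (n + 1)) : ZeroNerve S n :=
  ⟨fun i => x.1 i.succ, fun _ h =>
    x.2 n.succ_ne_zero (by rw [List.ofFn_succ, List.prod_cons, h, mul_zero])⟩

/-- With entries counted from `0`: the tuple `(x₀, …, xⱼ xⱼ₊₁, …, xₙ)` for `j < n`, and
`(x₀, …, xₙ₋₁)` for `j = n`. -/
def contract (j : Fin (n + 1)) (x : ZeroNerve S (n + 1)) : ZeroNerve S n :=
  ⟨j.contractNth (· * ·) x.1, fun _ h => by
    obtain ⟨c, hc⟩ := exists_prod_contractNth_mul j x.1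
    exact x.2 n.succ_ne_zero (by rw [hc, h, zero_mul])⟩

theorem contract_contract (x : ZeroNerve S (n + 2)) (i : Fin (n + 1)) (j : Fin (n + 2))
    (h : (j : ℕ) ≤ i) :
    (x.contract j).contract i = (x.contract i.succ).contract (Fin.castLT j (by omega)) := by
  apply Subtype.ext
  funext k
  rcases i with ⟨i, hi⟩
  rcases j with ⟨j, hj⟩
  rcases k with ⟨k, hk⟩
  simp only [ZeroNerve.contract, Fin.contractNth, Fin.castSucc_mk, Fin.succ_mk, Fin.castLT_mk]
  simp only at h
  split_ifs <;> first | rfl | omega | (simp only [mul_assoc])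

end ZeroNerve

variable (S) (A : Type w) [AddCommGroup A] [ZeroModule S A]

/-- The coboundary operator
`(∂f)(x₁, …, xₙ₊₁) = x₁ f(x₂, …, xₙ₊₁) + ∑ (-1)^i f(x₁, …, xᵢ xᵢ₊₁, …, xₙ₊₁)
  + (-1)^(n+1) f(x₁, …, xₙ)`, with the last term included in the sum. -/
def zeroCoboundary (n : ℕ) : ZeroCochain S A n →+ ZeroCochain S A (n + 1) :=
  AddMonoidHom.mk'
    (fun f x => ZeroModule.act x.head (f x.tail) +
      ∑ j : Fin (n + 1), (-1 : ℤ) ^ ((j : ℕ) + 1) • f (x.contract j))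
    (by
      intro f g
      funext x
      simp only [Pi.add_apply, ZeroModule.act_add, smul_add, Finset.sum_add_distrib]
      abel)

theorem zeroCoboundary_comp (n : ℕ)
    (f : ZeroCochain S A n) :
    zeroCoboundary S A (n + 1) (zeroCoboundary S A n f) = 0 := by
  have act_sum : ∀ (s : {s : S // s ≠ 0}) (m : ℕ) (e : Fin m → ℤ) (g : Fin m → A),
      ZeroModule.act s (∑ j, e j • g j) = ∑ j, e j • ZeroModule.act s (g j) := by
    intro s m e g
    have := map_sum (AddMonoidHom.mk' (ZeroModule.act (A := A) s) (ZeroModule.act_add s))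
      (fun j => e j • g j) Finset.univ
    simp only [map_zsmul] at this
    exact this
  funext x
  have key : ∑ j : Fin (n + 2), (-1 : ℤ) ^ ((j : ℕ) + 1) • ∑ i : Fin (n + 1),
      (-1 : ℤ) ^ ((i : ℕ) + 1) • f ((x.contract j).contract i) = 0 := by
    simp only [Finset.smul_sum, smul_smul]
    rw [← Finset.sum_product', Finset.univ_product_univ]
    rw [← Finset.sum_add_sum_compl ({p : Fin (n+2) × Fin (n+1) | (p.1 : ℕ) ≤ p.2} : Finset _),
      ← eq_neg_iff_add_eq_zero, ← Finset.sum_neg_distrib]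
    refine Finset.sum_bij' (fun p hp => (p.2.succ, Fin.castLT p.1 ?_))
      (fun p hp => (p.2.castSucc, p.1.pred ?_)) ?_ ?_ ?_ ?_ ?_
    · have := (Finset.mem_filter.mp hp).2; omega
    · rintro h0
      simp [h0] at hp
    · intro p hp; simp at hp ⊢; omega
    · intro p hp; simp at hp ⊢; omega
    · rintro ⟨j, i⟩ hp; simp
    · rintro ⟨j, i⟩ hp; simp
    · rintro ⟨j, i⟩ hp
      simp only [Finset.mem_filter, Finset.mem_univ, true_and] at hp
      rw [ZeroNerve.contract_contract x i j hp, ← neg_smul]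
      congr 1
      simp [pow_succ, mul_comm]
  have h0 : ∀ j : Fin (n + 1), (x.contract j.succ).head = x.head := fun j =>
    Subtype.ext (by simp [ZeroNerve.head, ZeroNerve.contract, Fin.contractNth])
  have h1 : ∀ j : Fin (n + 1), (x.contract j.succ).tail = x.tail.contract j := fun j => by
    apply Subtype.ext; funext k
    simp [ZeroNerve.tail, ZeroNerve.contract, Fin.contractNth]
  have h2 : (x.contract 0).tail = x.tail.tail := by
    apply Subtype.ext; funext k
    simp [ZeroNerve.tail, ZeroNerve.contract, Fin.contractNth]
  have h3 : x.head.1 * x.tail.head.1 = (x.contract 0).head.1 :=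
    by simp [ZeroNerve.head, ZeroNerve.tail, ZeroNerve.contract, Fin.contractNth]
  have h4 : ZeroModule.act x.head (ZeroModule.act x.tail.head (f x.tail.tail))
      = ZeroModule.act (x.contract 0).head (f x.tail.tail) := by
    rw [ZeroModule.act_act _ _ (h3 ▸ (x.contract 0).head.2)]
    simp only [h3]
  simp only [zeroCoboundary, AddMonoidHom.mk'_apply, ZeroModule.act_add, act_sum, smul_add,
    Finset.sum_add_distrib, key, h4, Pi.zero_apply]
  rw [Fin.sum_univ_succ (n := n + 1)]
  simp [h0, h1, h2, pow_succ]
  abel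

/-- The `n`-dimensional 0-cocycles. -/
def zeroCocycles (n : ℕ) : AddSubgroup (ZeroCochain S A n) :=
  (zeroCoboundary S A n).ker

/-- The `n`-dimensional 0-coboundaries. -/
def zeroCoboundaries : (n : ℕ) → AddSubgroup (ZeroCochain S A n)
  | 0 => ⊥
  | n + 1 => (zeroCoboundary S A n).range

theorem zeroCoboundaries_le_zeroCocycles (n : ℕ) :
    zeroCoboundaries S A n ≤ zeroCocycles S A n := by
  cases n with
  | zero => exact bot_le
  | succ n =>
    rintro _ ⟨f, rfl⟩
    exact zeroCoboundary_comp S A n f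

/-- The 0-cohomology group: 0-cocycles modulo 0-coboundaries. -/
abbrev ZeroCohomology (n : ℕ) : Type (max u w) :=
  zeroCocycles S A n ⧸ (zeroCoboundaries S A n).addSubgroupOf (zeroCocycles S A n)

/-- The 0-cohomological dimension: the least `n` such that the `(n+1)`-st 0-cohomology group
vanishes for every 0-module (`⊤` if there is no such `n`). -/
noncomputable def zeroCohomologicalDimension : ℕ∞ :=
  ⨅ (n : ℕ) (_ : ∀ (B : Type w) [AddCommGroup B] [ZeroModule S B],
    Subsingleton (ZeroCohomology S B (n + 1))), (n : ℕ∞)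

end Cohomology

/-! ### Projective representations -/

section Projective

variable {S : Type u} [Mul S] (K : Type k) [Field K] {R : Type l} [Ring R] [Algebra K R]

/-- A map `Γ` from a semigroup to a `K`-algebra `R` (such as the matrix algebra of degree `n`) is a
projective representation if `Γ(xy)` and `Γ(x)Γ(y)` vanish simultaneously and there is a factor set
`ρ`, a partial map to `Kˣ` defined where `Γ(xy) ≠ 0`, with `Γ(x)Γ(y) = ρ(x,y) Γ(xy)`. -/
def IsProjectiveRep (Γ : S → R) : Prop :=
  (∀ x y : S, Γ (x * y) = 0 ↔ Γ x * Γ y = 0) ∧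
  ∃ ρ : {p : S × S // Γ (p.1 * p.2) ≠ 0} → Kˣ,
    ∀ p, Γ p.1.1 * Γ p.1.2 = (ρ p : K) • Γ (p.1.1 * p.1.2)

/-- Two maps to `R` are equivalent if they choose different representatives of the same classes
modulo multiplication by nonzero scalars. -/
def ProjectivelyEquivalent (Γ Γ' : S → R) : Prop :=
  ∃ c : S → Kˣ, ∀ x, Γ x = (c x : K) • Γ' x

/-- `Γ` is equivalent to a linear representation, i.e. to a semigroup homomorphism into the
multiplicative semigroup of `R`. -/
def IsLinearizable (Γ : S → R) : Prop :=
  ∃ Δ : S →ₙ* R, ProjectivelyEquivalent K Γ Δ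

end Projective

/-! Both kinds of 0-free monoid share one feature: every nonzero element is the value of exactly one
word (`ZeroFreePresentation`). Cochains and representations can then be built by recursion on words.

Cohomology: a cocycle f is first changed by a coboundary so that f(1, …) = 0 and all its values are
fixed by 1, which need not act as the identity (`exists_normalized_cocycle`). For a letter a, the
equation ∂g = f at (a, w, y) suggests g(aw, y) = a g(w, y) − f(a, w, y); with g(1, y) = 0 this
defines g (`primitiveAux`). The cocycle f − ∂g vanishes when its first argument is 1 or a letter,
and the cocycle identity carries this to all words (`eq_zero_of_vanishes_on_letters`).

Representations: if Γ 0 = 0, multiplying the values of Γ along the letters of a word is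
multiplicative because words concatenate, and it changes Γ only by scalars. If Γ 0 ≠ 0, the scalars
by which the Γ x act on Γ 0 already trivialize the factor set. -/

/-- A presentation of a monoid with zero as a 0-free monoid: a homomorphism from a free monoid which
is bijective over the nonzero elements, together with its partial inverse. -/
structure ZeroFreePresentation (M : Type u) [MonoidWithZero M] (X : Type v) where
  /-- evaluation of words -/
  eval : FreeMonoid X →* M
  /-- the word representing a nonzero element -/
  word : M → FreeMonoid X
  eval_word : ∀ m, m ≠ 0 → eval (word m) = m
  word_eval : ∀ w, eval w ≠ 0 → word (eval w) = w

theorem ZeroFreePresentation.exists_of_injective {M : Type u} [MonoidWithZero M] {X : Type v}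
    (p : FreeMonoid X →* M) (hs : ∀ m, m ≠ 0 → ∃ w, p w = m)
    (hi : ∀ u v, p u ≠ 0 → p u = p v → u = v) : Nonempty (ZeroFreePresentation M X) := by
  classical
  refine ⟨⟨p, fun m => if h : m ≠ 0 then (hs m h).choose else 1, fun m h => ?_, fun w h => ?_⟩⟩
  · rw [dif_pos h]
    exact (hs m h).choose_spec
  · rw [dif_pos h]
    exact (hi _ _ h (hs _ h).choose_spec.symm).symm

theorem IsZeroFree.exists_presentation {M : Type u} [MonoidWithZero M]
    (hM : IsZeroFree.{u, v} M) : ∃ X : Type v, Nonempty (ZeroFreePresentation M X) := by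
  obtain ⟨X, ⟨I, hI, ⟨e⟩⟩ | ⟨⟨e⟩⟩⟩ := hM
  · refine ⟨X, ZeroFreePresentation.exists_of_injective
      (e.symm.toMonoidHom.comp (reesCon I hI).mk') (fun m _ => ?_) (fun u v hu huv => ?_)⟩
    · obtain ⟨w, hw⟩ := Con.mk'_surjective (c := reesCon I hI) (e m)
      exact ⟨w, (congrArg e.symm hw).trans (e.symm_apply_apply m)⟩
    · have huv' : (reesCon I hI).mk' u = (reesCon I hI).mk' v := e.symm.injective huv
      rcases (Con.eq (reesCon I hI)).1 huv' with h | h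
      · exact h
      · exfalso
        apply hu
        -- With z a lift of the zero of M, both u and zu lie in the ideal, so the class of u is a
        -- multiple of zero.
        obtain ⟨z, hz⟩ := Con.mk'_surjective (c := reesCon I hI) (e 0)
        have h1 : (reesCon I hI).mk' u = (reesCon I hI).mk' (z * u) :=
          (Con.eq (reesCon I hI)).2 (Or.inr ⟨h.1, (hI.2 _ h.1 z).1⟩)
        change e.symm ((reesCon I hI).mk' u) = 0
        rw [h1, map_mul, hz, map_mul, MulEquiv.symm_apply_apply, zero_mul]
  · have e0 : e 0 = 0 := by
      have := map_mul e 0 (e.symm 0)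
      rwa [zero_mul, MulEquiv.apply_symm_apply, mul_zero] at this
    refine ⟨X, ZeroFreePresentation.exists_of_injective
      (e.symm.toMonoidHom.comp WithZero.coeMonoidHom) (fun m hm => ?_) (fun u v hu huv => ?_)⟩
    · obtain ⟨w, hw⟩ := WithZero.ne_zero_iff_exists.1
        (fun h => hm (e.injective (h.trans e0.symm)) : e m ≠ 0)
      exact ⟨w, by simp [hw]⟩
    · exact WithZero.coe_injective (e.symm.injective huv)

/-! ### Cochains as total functions, and normalization of cocycles -/

section ExtensionByZero

open Classical in
/-- The action of `S \ 0`, extended by zero. -/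
noncomputable def ZeroModule.actZero {S : Type u} {A : Type w} [MonoidWithZero S] [AddCommGroup A]
    [ZeroModule S A] (s : S) : A →+ A :=
  if h : s ≠ 0 then AddMonoidHom.mk' (ZeroModule.act ⟨s, h⟩) (ZeroModule.act_add _) else 0

open Classical in
/-- The extension by zero of a cochain to all tuples. -/
noncomputable def ZeroCochain.extend {S : Type u} {A : Type w} [MonoidWithZero S] [AddCommGroup A]
    {n : ℕ} (f : ZeroCochain S A n) (x : Fin n → S) : A :=
  if h : (List.ofFn x).prod ≠ 0 then f ⟨x, fun _ => h⟩ else 0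

variable {S : Type u} {A : Type w} [MonoidWithZero S] [AddCommGroup A]

theorem ZeroCochain.extend_of_prod_ne_zero {n : ℕ} (f : ZeroCochain S A n) {x : Fin n → S}
    (h : (List.ofFn x).prod ≠ 0) : ZeroCochain.extend f x = f ⟨x, fun _ => h⟩ :=
  dif_pos h

theorem ZeroCochain.extend_of_prod_eq_zero {n : ℕ} (f : ZeroCochain S A n) {x : Fin n → S}
    (h : (List.ofFn x).prod = 0) : ZeroCochain.extend f x = 0 :=
  dif_neg (not_not.2 h)

/-- Positive degree matters: if 1 = 0, the empty tuple carries a 0-cochain value, but its product is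
0 and `extend` discards that value. -/
theorem ZeroCochain.extend_val {n : ℕ} (f : ZeroCochain S A (n + 1)) (x : ZeroNerve S (n + 1)) :
    ZeroCochain.extend f x.1 = f x :=
  f.extend_of_prod_ne_zero (x.2 n.succ_ne_zero)

theorem ZeroCochain.extend_add {n : ℕ} (f g : ZeroCochain S A n) (x : Fin n → S) :
    ZeroCochain.extend (f + g) x = ZeroCochain.extend f x + ZeroCochain.extend g x := by
  by_cases h : (List.ofFn x).prod = 0
  · simp [ZeroCochain.extend, h]
  · simp only [ZeroCochain.extend_of_prod_ne_zero _ h]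
    rfl

theorem ZeroCochain.extend_sub {n : ℕ} (f g : ZeroCochain S A n) (x : Fin n → S) :
    ZeroCochain.extend (f - g) x = ZeroCochain.extend f x - ZeroCochain.extend g x := by
  by_cases h : (List.ofFn x).prod = 0
  · simp [ZeroCochain.extend, h]
  · simp only [ZeroCochain.extend_of_prod_ne_zero _ h]
    rfl

theorem ZeroCochain.extend_zero {n : ℕ} (x : Fin n → S) :
    ZeroCochain.extend (0 : ZeroCochain S A n) x = 0 := by
  unfold ZeroCochain.extend
  split_ifs <;> rfl

theorem prod_ofFn_cons {n : ℕ} (a : S) (y : Fin n → S) :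
    (List.ofFn (Fin.cons a y : Fin (n + 1) → S)).prod = a * (List.ofFn y).prod := by
  simp [List.ofFn_succ]

theorem contractNth_zero_cons {n : ℕ} (a : S) (z : Fin (n + 1) → S) :
    (0 : Fin (n + 2)).contractNth (· * ·) (Fin.cons a z : Fin (n + 2) → S)
      = Fin.cons (a * z 0) (Fin.tail z) := by
  funext k
  refine Fin.cases ?_ (fun k => ?_) k <;> simp [Fin.contractNth, Fin.tail]

theorem contractNth_succ_cons {n : ℕ} (j : Fin (n + 1)) (a : S) (z : Fin (n + 1) → S) :
    j.succ.contractNth (· * ·) (Fin.cons a z : Fin (n + 2) → S)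
      = Fin.cons a (j.contractNth (· * ·) z) := by
  funext k
  refine Fin.cases ?_ (fun k => ?_) k <;> simp [Fin.contractNth]

theorem prod_contractNth_ne_zero {n : ℕ} (j : Fin (n + 1)) {x : Fin (n + 1) → S}
    (h : (List.ofFn x).prod ≠ 0) : (List.ofFn (j.contractNth (· * ·) x)).prod ≠ 0 := by
  intro h0
  obtain ⟨c, hc⟩ := exists_prod_contractNth_mul j x
  exact h (by rw [hc, h0, zero_mul])

variable [ZeroModule S A]

theorem ZeroModule.actZero_of_ne_zero {s : S} (h : s ≠ 0) (a : A) :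
    ZeroModule.actZero s a = ZeroModule.act ⟨s, h⟩ a := by
  simp [ZeroModule.actZero, h]

theorem ZeroModule.actZero_actZero {s t : S} (h : s * t ≠ 0) (a : A) :
    ZeroModule.actZero s (ZeroModule.actZero t a) = ZeroModule.actZero (s * t) a := by
  rw [actZero_of_ne_zero (left_ne_zero_of_mul h), actZero_of_ne_zero (right_ne_zero_of_mul h),
    actZero_of_ne_zero h, ZeroModule.act_act _ _ h]

theorem ZeroModule.actZero_one_actZero (s : S) (a : A) :
    ZeroModule.actZero (1 : S) (ZeroModule.actZero s a) = ZeroModule.actZero s a := by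
  by_cases h : s = 0
  · simp [ZeroModule.actZero, h]
  · rw [ZeroModule.actZero_actZero (by rwa [one_mul]), one_mul]

theorem ZeroModule.actZero_actZero_one (s : S) (a : A) :
    ZeroModule.actZero s (ZeroModule.actZero (1 : S) a) = ZeroModule.actZero s a := by
  by_cases h : s = 0
  · simp [ZeroModule.actZero, h]
  · rw [ZeroModule.actZero_actZero (by rwa [mul_one]), mul_one]

theorem extend_zeroCoboundary {n : ℕ} (f : ZeroCochain S A (n + 1)) {x : Fin (n + 2) → S}
    (h : (List.ofFn x).prod ≠ 0) :
    ZeroCochain.extend (zeroCoboundary S A (n + 1) f) x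
      = ZeroModule.actZero (x 0) (ZeroCochain.extend f (Fin.tail x))
        + ∑ j : Fin (n + 2), (-1 : ℤ) ^ ((j : ℕ) + 1) •
          ZeroCochain.extend f (j.contractNth (· * ·) x) := by
  rw [ZeroCochain.extend_of_prod_ne_zero _ h]
  let z : ZeroNerve S (n + 2) := ⟨x, fun _ => h⟩
  have h1 : ZeroModule.actZero (x 0) (ZeroCochain.extend f (Fin.tail x))
      = ZeroModule.act z.head (f z.tail) := by
    rw [ZeroModule.actZero_of_ne_zero (s := x 0) z.head.2, ← ZeroCochain.extend_val f z.tail]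
    rfl
  have h2 (j : Fin (n + 2)) : ZeroCochain.extend f (j.contractNth (· * ·) x)
      = f (z.contract j) := ZeroCochain.extend_val f (z.contract j)
  rw [h1]
  simp only [h2]
  rfl

/-- Splitting off the contraction that alters the first argument gives the form needed for recursion
on that argument; the index shift flips the sign of the remaining sum. -/
theorem extend_zeroCoboundary_cons {n : ℕ} (f : ZeroCochain S A (n + 1)) {a : S}
    {z : Fin (n + 1) → S} (h : a * (List.ofFn z).prod ≠ 0) :
    ZeroCochain.extend (zeroCoboundary S A (n + 1) f) (Fin.cons a z)
      = ZeroModule.actZero a (ZeroCochain.extend f z)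
        - ZeroCochain.extend f (Fin.cons (a * z 0) (Fin.tail z))
        - ∑ j : Fin (n + 1), (-1 : ℤ) ^ ((j : ℕ) + 1) •
          ZeroCochain.extend f (Fin.cons a (j.contractNth (· * ·) z)) := by
  rw [extend_zeroCoboundary f (by rwa [prod_ofFn_cons]), Fin.sum_univ_succ]
  simp only [contractNth_zero_cons, contractNth_succ_cons, Fin.cons_zero, Fin.tail_cons,
    Fin.val_succ, pow_succ _ (_ + 1), mul_neg, mul_one, neg_smul, Finset.sum_neg_distrib]
  simp
  abel

/-- Every cocycle is cohomologous to one that vanishes when its first argument is `1` and takes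
values fixed by the (possibly non-unital) action of `1`. -/
theorem exists_normalized_cocycle {n : ℕ} (f : ZeroCochain S A (n + 2))
    (hf : zeroCoboundary S A (n + 2) f = 0) :
    ∃ g : ZeroCochain S A (n + 1),
      (∀ y : Fin (n + 1) → S,
        ZeroCochain.extend (f + zeroCoboundary S A (n + 1) g) (Fin.cons 1 y) = 0) ∧
      ∀ x : Fin (n + 2) → S,
        ZeroModule.actZero (1 : S) (ZeroCochain.extend (f + zeroCoboundary S A (n + 1) g) x)
          = ZeroCochain.extend (f + zeroCoboundary S A (n + 1) g) x := by
  let e : A →+ A := ZeroModule.actZero (1 : S)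
  -- As e is idempotent, this is −1 on the image of e and 1 on its kernel. One correction thus both
  -- removes f(1, …) and projects the values to the image of e.
  let φ : A →+ A := AddMonoidHom.id A - (2 : ℤ) • e
  let g : ZeroCochain S A (n + 1) := fun y => φ (ZeroCochain.extend f (Fin.cons 1 y.1))
  have hg (y : Fin (n + 1) → S) :
      ZeroCochain.extend g y = φ (ZeroCochain.extend f (Fin.cons 1 y)) := by
    by_cases h : (List.ofFn y).prod = 0
    · rw [g.extend_of_prod_eq_zero h,
        f.extend_of_prod_eq_zero (by rw [prod_ofFn_cons, h, mul_zero]), map_zero]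
    · rw [g.extend_of_prod_ne_zero h]
  have key (x : Fin (n + 2) → S) (h : (List.ofFn x).prod ≠ 0) :
      ZeroCochain.extend (f + zeroCoboundary S A (n + 1) g) x
        = e (ZeroCochain.extend f x)
          - ZeroModule.actZero (x 0) (ZeroCochain.extend f (Fin.cons 1 (Fin.tail x))) := by
    -- The cocycle identity at (1, x) evaluates the alternating sum of the f(1, contracted x) as e
    -- f(x) − f(x).
    have h1 := extend_zeroCoboundary_cons f (a := 1) (z := x) (by rwa [one_mul])
    rw [hf, ZeroCochain.extend_zero, one_mul, Fin.cons_self_tail] at h1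
    have h2 := eq_of_sub_eq_zero h1.symm
    rw [ZeroCochain.extend_add, extend_zeroCoboundary g h]
    simp only [hg, ← map_zsmul, ← map_sum]
    rw [← h2]
    have h3 (a : A) : ZeroModule.actZero (x 0) (e a) = ZeroModule.actZero (x 0) a :=
      ZeroModule.actZero_actZero_one _ _
    have h4 (a : A) : e (e a) = e a := ZeroModule.actZero_one_actZero _ _
    change ZeroCochain.extend f x + (ZeroModule.actZero (x 0) (_ - (2 : ℤ) • e _)
      + ((e _ - _) - (2 : ℤ) • e (e _ - _))) = _
    simp only [map_sub, map_add, AddMonoidHom.id_apply, h3, h4, two_zsmul]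
    abel
  refine ⟨g, fun y => ?_, fun x => ?_⟩
  · by_cases h : (List.ofFn y).prod = 0
    · exact ZeroCochain.extend_of_prod_eq_zero _ (by rw [prod_ofFn_cons, h, mul_zero])
    · rw [key _ (by rwa [prod_ofFn_cons, one_mul])]
      exact sub_self _
  · by_cases h : (List.ofFn x).prod = 0
    · rw [ZeroCochain.extend_of_prod_eq_zero _ h, map_zero]
    · rw [key _ h, map_sub, ZeroModule.actZero_one_actZero, ZeroModule.actZero_one_actZero]

end ExtensionByZero

namespace ZeroFreePresentation

/-! ### Vanishing of 0-cohomology in degrees at least 2 -/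

section Cohomology

variable {M : Type u} [MonoidWithZero M] {X : Type v} (p : ZeroFreePresentation M X)
  {A : Type w} [AddCommGroup A] [ZeroModule M A]

/-- The values on `(w, y)`, by recursion on the word `w`, of a cochain with coboundary `f`. -/
noncomputable def primitiveAux {n : ℕ} (f : ZeroCochain M A (n + 2)) (y : Fin n → M) : List X → A
  | [] => 0
  | a :: l => ZeroModule.actZero (p.eval (FreeMonoid.of a)) (primitiveAux f y l)
      - ZeroCochain.extend f
          (Fin.cons (p.eval (FreeMonoid.of a)) (Fin.cons (p.eval (FreeMonoid.ofList l)) y))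

/-- A cochain whose coboundary is `f`, for suitably normalized cocycles `f`. -/
noncomputable def primitive {n : ℕ} (f : ZeroCochain M A (n + 2)) : ZeroCochain M A (n + 1) :=
  fun x => p.primitiveAux f (Fin.tail x.1) (FreeMonoid.toList (p.word (x.1 0)))

theorem eval_ofList_cons (a : X) (l : List X) :
    p.eval (FreeMonoid.ofList (a :: l))
      = p.eval (FreeMonoid.of a) * p.eval (FreeMonoid.ofList l) := by
  rw [FreeMonoid.ofList_cons, map_mul]

theorem extend_primitive {n : ℕ} (f : ZeroCochain M A (n + 2)) (l : List X) {y : Fin n → M}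
    (h : p.eval (FreeMonoid.ofList l) * (List.ofFn y).prod ≠ 0) :
    ZeroCochain.extend (p.primitive f) (Fin.cons (p.eval (FreeMonoid.ofList l)) y)
      = p.primitiveAux f y l := by
  rw [ZeroCochain.extend_of_prod_ne_zero _ (by rwa [prod_ofFn_cons])]
  simp [primitive, p.word_eval _ (left_ne_zero_of_mul h)]

theorem exists_cons_eq {n : ℕ} (z : Fin (n + 1) → M) (h : (List.ofFn z).prod ≠ 0) :
    ∃ (l : List X) (y : Fin n → M), z = Fin.cons (p.eval (FreeMonoid.ofList l)) y := by
  refine ⟨FreeMonoid.toList (p.word (z 0)), Fin.tail z, ?_⟩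
  have h0 : z 0 ≠ 0 := by
    rw [List.ofFn_succ, List.prod_cons] at h
    exact left_ne_zero_of_mul h
  rw [FreeMonoid.ofList_toList, p.eval_word _ h0, Fin.cons_self_tail]

theorem actZero_one_primitiveAux {n : ℕ} (f : ZeroCochain M A (n + 2))
    (h1 : ∀ x, ZeroModule.actZero (1 : M) (ZeroCochain.extend f x) = ZeroCochain.extend f x)
    (y : Fin n → M) (l : List X) :
    ZeroModule.actZero (1 : M) (p.primitiveAux f y l) = p.primitiveAux f y l := by
  cases l with
  | nil => simp [primitiveAux]
  | cons a l => rw [primitiveAux, map_sub, h1, ZeroModule.actZero_one_actZero]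

/-- In the cocycle identity at (a, w, y) every term but h(aw, y) begins with the letter a or is a
multiple of h(w, y), so induction on the word applies. -/
theorem eq_zero_of_vanishes_on_letters {n : ℕ} (h : ZeroCochain M A (n + 2))
    (hc : zeroCoboundary M A (n + 2) h = 0)
    (h1 : ∀ y, ZeroCochain.extend h (Fin.cons 1 y) = 0)
    (ha : ∀ (a : X) y, ZeroCochain.extend h (Fin.cons (p.eval (FreeMonoid.of a)) y) = 0) :
    h = 0 := by
  have key : ∀ (l : List X) (y : Fin (n + 1) → M),
      ZeroCochain.extend h (Fin.cons (p.eval (FreeMonoid.ofList l)) y) = 0 := by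
    intro l
    induction l with
    | nil => simpa using h1
    | cons a l ih =>
      intro y
      rw [p.eval_ofList_cons]
      by_cases h0 : p.eval (FreeMonoid.of a) * p.eval (FreeMonoid.ofList l) *
          (List.ofFn y).prod = 0
      · exact ZeroCochain.extend_of_prod_eq_zero _ (by rw [prod_ofFn_cons, h0])
      · have := extend_zeroCoboundary_cons h (a := p.eval (FreeMonoid.of a))
          (z := Fin.cons (p.eval (FreeMonoid.ofList l)) y)
          (by rwa [prod_ofFn_cons, ← mul_assoc])
        simpa [hc, ZeroCochain.extend_zero, ih, ha] using this
  funext x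
  obtain ⟨l, y, hx⟩ := p.exists_cons_eq x.1 (x.2 (Nat.succ_ne_zero _))
  rw [← ZeroCochain.extend_val h x, hx, key]
  rfl

/-- By `eq_zero_of_vanishes_on_letters`, only first arguments 1 and a letter a need checking. For a,
the recursion leaves the alternating sum of the terms g(a, contracted z) = −f(a, 1, contracted z),
which must cancel. -/
theorem zeroCoboundary_primitive {n : ℕ} (f : ZeroCochain M A (n + 2))
    (hf : zeroCoboundary M A (n + 2) f = 0)
    (h1 : ∀ y, ZeroCochain.extend f (Fin.cons 1 y) = 0)
    (he : ∀ x, ZeroModule.actZero (1 : M) (ZeroCochain.extend f x) = ZeroCochain.extend f x) :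
    zeroCoboundary M A (n + 1) (p.primitive f) = f := by
  have hnil : p.eval (FreeMonoid.ofList []) = 1 := by simp
  have hsingle (a : X) : FreeMonoid.ofList [a] = FreeMonoid.of a := FreeMonoid.ofList_singleton a
  refine (sub_eq_zero.1 (p.eq_zero_of_vanishes_on_letters (f - _) ?_ (fun z => ?_)
    (fun a z => ?_))).symm
  · rw [map_sub, hf, zeroCoboundary_comp, sub_zero]
  · by_cases h : (List.ofFn z).prod = 0
    · exact ZeroCochain.extend_of_prod_eq_zero _ (by rw [prod_ofFn_cons, h, mul_zero])
    have hg (y : Fin n → M) (hy : (List.ofFn y).prod ≠ 0) :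
        ZeroCochain.extend (p.primitive f) (Fin.cons 1 y) = 0 := by
      have := p.extend_primitive f [] (y := y) (by rwa [hnil, one_mul])
      rwa [hnil] at this
    have hs (j : Fin (n + 1)) :
        ZeroCochain.extend (p.primitive f) (Fin.cons 1 (j.contractNth (· * ·) z)) = 0 :=
      hg _ (prod_contractNth_ne_zero j h)
    rw [ZeroCochain.extend_sub, h1, extend_zeroCoboundary_cons _ (by rwa [one_mul])]
    simp only [hs, smul_zero, Finset.sum_const_zero, one_mul, Fin.cons_self_tail]
    obtain ⟨l, y, rfl⟩ := p.exists_cons_eq z h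
    rw [p.extend_primitive f l (by rwa [← prod_ofFn_cons]), p.actZero_one_primitiveAux f he]
    simp
  · by_cases h : p.eval (FreeMonoid.of a) * (List.ofFn z).prod = 0
    · exact ZeroCochain.extend_of_prod_eq_zero _ (by rw [prod_ofFn_cons, h])
    have hz := right_ne_zero_of_mul h
    have hs (y : Fin n → M) (hy : p.eval (FreeMonoid.of a) * (List.ofFn y).prod ≠ 0) :
        ZeroCochain.extend (p.primitive f) (Fin.cons (p.eval (FreeMonoid.of a)) y)
          = - ZeroCochain.extend f (Fin.cons (p.eval (FreeMonoid.of a)) (Fin.cons 1 y)) := by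
      have := p.extend_primitive f [a] (y := y) (by rwa [hsingle])
      rw [hsingle] at this
      rw [this, primitiveAux, primitiveAux, hnil, map_zero, zero_sub]
    have hs' (j : Fin (n + 1)) := hs (j.contractNth (· * ·) z) (fun h0 => by
      have := prod_contractNth_ne_zero j.succ
        (x := (Fin.cons (p.eval (FreeMonoid.of a)) z : Fin (n + 2) → M))
        (by rwa [prod_ofFn_cons])
      rw [contractNth_succ_cons, prod_ofFn_cons] at this
      exact this h0)
    -- At (a, 1, z) the two copies of f(a, z) cancel and a f(1, z) = 0, so the leftover sum is zero.
    have hcoc := extend_zeroCoboundary_cons f (a := p.eval (FreeMonoid.of a))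
      (z := (Fin.cons 1 z : Fin (n + 2) → M)) (by rwa [prod_ofFn_cons, one_mul])
    rw [hf, ZeroCochain.extend_zero, h1, map_zero, Fin.cons_zero, mul_one, Fin.tail_cons,
      Fin.sum_univ_succ] at hcoc
    simp only [contractNth_zero_cons, contractNth_succ_cons, one_mul, Fin.cons_self_tail,
      Fin.val_succ, pow_succ _ (_ + 1), mul_neg, mul_one, neg_smul, Finset.sum_neg_distrib] at hcoc
    rw [ZeroCochain.extend_sub, extend_zeroCoboundary_cons _ h]
    simp only [hs', smul_neg, Finset.sum_neg_distrib]
    obtain ⟨l, y, rfl⟩ := p.exists_cons_eq z hz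
    rw [p.extend_primitive f l (by rwa [← prod_ofFn_cons]), Fin.cons_zero, Fin.tail_cons,
      ← p.eval_ofList_cons, p.extend_primitive f (a :: l)
        (by rwa [p.eval_ofList_cons, mul_assoc, ← prod_ofFn_cons]), primitiveAux]
    simp at hcoc
    simpa using hcoc.symm

theorem subsingleton_zeroCohomology (p : ZeroFreePresentation M X) (n : ℕ) :
    Subsingleton (ZeroCohomology M A (n + 2)) := by
  refine QuotientAddGroup.subsingleton_iff.2 (AddSubgroup.addSubgroupOf_eq_top.2 fun f hf => ?_)
  obtain ⟨g, hg1, hge⟩ := exists_normalized_cocycle f hf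
  refine ⟨p.primitive (f + zeroCoboundary M A (n + 1) g) - g, ?_⟩
  rw [map_sub, p.zeroCoboundary_primitive _ _ hg1 hge, add_sub_cancel_right]
  rw [map_add, zeroCoboundary_comp, add_zero]
  exact hf

end Cohomology

/-! ### Linearization of projective representations -/

section Projective

variable {M : Type u} [MonoidWithZero M] {X : Type v} (p : ZeroFreePresentation M X)
  {K : Type k} [Field K] {R : Type l} [Ring R] [Algebra K R]

/-- The product of the values of `Γ` at the letters of a word, times `e` on the right. -/
def letterProd (Γ : M → R) (e : R) (l : List X) : R :=
  l.foldr (fun a r => Γ (p.eval (FreeMonoid.of a)) * r) e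

/-- The factor e ending the product for u meets the product for v, which must absorb it; the unit of
R would not do as e, since Γ 1 need not be a scalar. -/
theorem letterProd_append (Γ : M → R) (e : R) (u v : List X)
    (h : e * p.letterProd Γ e v = p.letterProd Γ e v) :
    p.letterProd Γ e (u ++ v) = p.letterProd Γ e u * p.letterProd Γ e v := by
  induction u with
  | nil => exact h.symm
  | cons a u ih =>
    change _ * p.letterProd Γ e (u ++ v) = _ * p.letterProd Γ e u * _
    rw [ih, mul_assoc]

end Projective

end ZeroFreePresentation

section Projective

variable {M : Type u} [MonoidWithZero M] {K : Type k} [Field K] {R : Type l} [Ring R] [Algebra K R]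

theorem IsProjectiveRep.exists_smul {Γ : M → R} (hΓ : IsProjectiveRep K Γ) {x y : M}
    (h : Γ (x * y) ≠ 0) : ∃ c : Kˣ, Γ x * Γ y = c • Γ (x * y) := by
  obtain ⟨ρ, hρ⟩ := hΓ.2
  exact ⟨ρ ⟨(x, y), h⟩, hρ ⟨(x, y), h⟩⟩

theorem IsProjectiveRep.ne_zero_left {Γ : M → R} (hΓ : IsProjectiveRep K Γ) {x y : M}
    (h : Γ (x * y) ≠ 0) : Γ x ≠ 0 := fun h0 => h ((hΓ.1 x y).2 (by rw [h0, zero_mul]))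

theorem IsProjectiveRep.ne_zero_right {Γ : M → R} (hΓ : IsProjectiveRep K Γ) {x y : M}
    (h : Γ (x * y) ≠ 0) : Γ y ≠ 0 := fun h0 => h ((hΓ.1 x y).2 (by rw [h0, mul_zero]))

/-- Since x0 = 0, left multiplication by Γ x scales Γ 0 by some c x. Evaluating Γ x Γ y Γ 0 in two
ways shows that the factor set is c x c y / c (xy), so Γ / c is multiplicative. -/
theorem IsProjectiveRep.isLinearizable_of_map_zero_ne_zero {Γ : M → R}
    (hΓ : IsProjectiveRep K Γ) (h0 : Γ 0 ≠ 0) : IsLinearizable K Γ := by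
  have hx (x : M) : ∃ c : Kˣ, Γ x * Γ 0 = c • Γ 0 := by
    have := hΓ.exists_smul (x := x) (y := 0) (by rwa [mul_zero])
    rwa [mul_zero] at this
  choose c hc using hx
  have hne (x : M) : Γ x ≠ 0 := hΓ.ne_zero_left (y := 0) (by rwa [mul_zero])
  have hmul (x y : M) : Γ x * Γ y = (c x * c y * (c (x * y))⁻¹) • Γ (x * y) := by
    obtain ⟨r, hr⟩ := hΓ.exists_smul (hne (x * y))
    have h1 : (r * c (x * y)) • Γ 0 = (c y * c x) • Γ 0 := by
      rw [mul_smul, ← hc (x * y), ← smul_mul_assoc, ← hr, mul_assoc, hc y, mul_smul_comm, hc x,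
        mul_smul]
    have h2 : r * c (x * y) = c y * c x :=
      Units.ext (smul_left_injective K h0 h1)
    rw [hr, mul_comm (c x), ← h2, mul_inv_cancel_right]
  refine ⟨⟨fun x => (c x)⁻¹ • Γ x, fun x y => ?_⟩, c, fun x => ?_⟩
  · rw [smul_mul_assoc, mul_smul_comm, hmul, smul_smul, smul_smul]
    congr 1
    group
    rw [mul_assoc, mul_comm]
    simp [mul_assoc]
  · exact (smul_inv_smul (c x) (Γ x)).symm

theorem ZeroFreePresentation.isLinearizable {X : Type v} (p : ZeroFreePresentation M X)
    {Γ : M → R} (hΓ : IsProjectiveRep K Γ) : IsLinearizable K Γ := by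
  classical
  by_cases h0 : Γ 0 = 0
  swap
  · exact hΓ.isLinearizable_of_map_zero_ne_zero h0
  obtain ⟨r, hr⟩ : ∃ r : Kˣ, Γ 1 ≠ 0 → Γ 1 * Γ 1 = r • Γ 1 := by
    by_cases h1 : Γ 1 = 0
    · exact ⟨1, fun h => absurd h1 h⟩
    · obtain ⟨r, hr⟩ := hΓ.exists_smul (x := 1) (y := 1) (by rwa [one_mul])
      exact ⟨r, fun _ => by rwa [one_mul] at hr⟩
  let e : R := r⁻¹ • Γ 1
  -- If Γ 1 Γ x = s Γ x, computing Γ 1 Γ 1 Γ x twice gives s² = rs, hence s = r.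
  have he (x : M) (hx : Γ x ≠ 0) : e * Γ x = Γ x := by
    obtain ⟨s, hs⟩ := hΓ.exists_smul (x := 1) (y := x) (by rwa [one_mul])
    rw [one_mul] at hs
    have h1 : Γ 1 ≠ 0 := hΓ.ne_zero_left (y := x) (by rwa [one_mul])
    have h2 : (s * s) • Γ x = (r * s) • Γ x := by
      rw [mul_smul, mul_smul, ← hs, ← mul_smul_comm, ← hs, ← mul_assoc, hr h1, smul_mul_assoc]
    have h3 : s * s = r * s := Units.ext (smul_left_injective K hx h2)
    rw [smul_mul_assoc, hs, mul_right_cancel h3, inv_smul_smul]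
  let φ : List X → R := p.letterProd Γ e
  have hφ (l : List X) : Γ (p.eval (FreeMonoid.ofList l)) ≠ 0 →
      ∃ c : Kˣ, Γ (p.eval (FreeMonoid.ofList l)) = c • φ l := by
    induction l with
    | nil => exact fun _ => ⟨r, by simp [φ, letterProd, e]⟩
    | cons a l ih =>
      rw [p.eval_ofList_cons]
      intro h
      obtain ⟨c, hc⟩ := ih (hΓ.ne_zero_right h)
      obtain ⟨s, hs⟩ := hΓ.exists_smul h
      refine ⟨s⁻¹ * c, ?_⟩
      rw [mul_smul, eq_inv_smul_iff, ← hs, hc, mul_smul_comm]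
      rfl
  have hne {x : M} (hx : Γ x ≠ 0) : x ≠ 0 := fun h => hx (h ▸ h0)
  -- Γ may vanish at a nonzero x whose letter product does not, so zero is imposed there.
  let Δ : M → R := fun x => if Γ x = 0 then 0 else φ (FreeMonoid.toList (p.word x))
  have hΔ (x : M) : ∃ c : Kˣ, Γ x = c • Δ x := by
    by_cases hx : Γ x = 0
    · exact ⟨1, by simp [Δ, hx]⟩
    · have := hφ (FreeMonoid.toList (p.word x))
      rw [FreeMonoid.ofList_toList, p.eval_word x (hne hx)] at this
      obtain ⟨c, hc⟩ := this hx
      exact ⟨c, by simp only [Δ, if_neg hx, hc]⟩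
  choose c hc using hΔ
  have hΔ' (x : M) : Δ x = (c x)⁻¹ • Γ x := by rw [hc x, inv_smul_smul]
  refine ⟨⟨Δ, fun x y => ?_⟩, c, hc⟩
  by_cases hxy : Γ (x * y) = 0
  · rw [hΔ' x, hΔ' y, smul_mul_assoc, mul_smul_comm, (hΓ.1 x y).1 hxy]
    simp [Δ, hxy]
  have hx := hΓ.ne_zero_left hxy
  have hy := hΓ.ne_zero_right hxy
  -- Words concatenate here because Γ 0 = 0 forces xy ≠ 0.
  have hw : p.word (x * y) = p.word x * p.word y := by
    have h : p.eval (p.word x * p.word y) = x * y := by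
      rw [map_mul, p.eval_word x (hne hx), p.eval_word y (hne hy)]
    rw [← h, p.word_eval]
    rw [h]
    exact hne hxy
  have hey : e * Δ y = Δ y := by rw [hΔ' y, mul_smul_comm, he y hy]
  simp only [Δ, if_neg hy] at hey
  simp only [Δ, if_neg hx, if_neg hy, if_neg hxy, hw, FreeMonoid.toList_mul]
  exact p.letterProd_append Γ e _ _ hey

end Projective

theorem theorem15 {M : Type u} [MonoidWithZero M] (hM : IsZeroFree.{u, v} M) :
    zeroCohomologicalDimension.{u, w} M ≤ 1 ∧
    (∀ n : ℕ, 2 ≤ n → ∀ (A : Type w) [AddCommGroup A] [ZeroModule M A],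
      Subsingleton (ZeroCohomology M A n)) ∧
    (∀ (K : Type k) [Field K] (n : ℕ) (Γ : M → Matrix (Fin n) (Fin n) K),
      IsProjectiveRep K Γ → IsLinearizable K Γ) ∧
    (∀ (K : Type k) [Field K] (V : Type l) [AddCommGroup V] [Module K V]
      (Γ : M → Module.End K V), IsProjectiveRep K Γ → IsLinearizable K Γ) := by
  obtain ⟨X, ⟨p⟩⟩ := hM.exists_presentation
  refine ⟨?_, fun n hn A _ _ => ?_, fun K _ n Γ hΓ => p.isLinearizable hΓ,
    fun K _ V _ _ Γ hΓ => p.isLinearizable hΓ⟩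
  · exact iInf₂_le_of_le 1 (fun B _ _ => p.subsingleton_zeroCohomology (A := B) 0) le_rfl
  · obtain ⟨n, rfl⟩ := Nat.exists_eq_add_of_le' hn
    exact p.subsingleton_zeroCohomology n
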